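/- Let $K,D\ge 1$ be integers, let $\mathcal Y\subset\mathbb R^D$ be a measurable set of finite Lebesgue measure, let $\mathcal L$ be the Lebesgue measure on $\mathcal Y$, and let $\|\cdot\|_2$ and $\langle\cdot,\cdot\rangle$ be the norm and inner product of the real space $L^2(\mathcal Y,\mathcal L)$ (and $\|\cdot\|_2$ also the norm of $L^2(\mathcal Y^3,\mathcal L^{\otimes 3})$). For a $K\times K$ transition matrix $Q$ with stationary distribution $\pi$ and $\mathbf f=(f_1,\dots,f_K)\in L^2(\mathcal Y,\mathcal L)^K$ put $$g^{Q,\mathbf f}(y_1,y_2,y_3)=\sum_{k_1,k_2,k_3=1}^K \pi(k_1)Q(k_1,k_2)Q(k_2,k_3)f_{k_1}(y_1)f_{k_2}(y_2)f_{k_3}(y_3).$$ Let $T_Q$ be the set of permutations $\tau$ of $\{1,\dots,K\}$ such that $Q(\tau(i),\tau(j))=Q(i,j)$ for all $i,j$. Let $G(\mathbf f)$ be the Gram matrix $(\langle f_i,f_j\rangle)_{i,j}$ and $A_Q$ the diagonal matrix with diagonal $\pi$. For a $K\times K$ real matrix $U$ with $U\mathbf 1_K=0$ and $G=G(\mathbf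 f)$ let $$\begin{aligned}\mathcal D(U)=\sum_{i,j=1}^K\Big\{&(Q^TA_QUGU^TA_QQ)_{i,j}G_{i,j}(QGQ^T)_{i,j}+(Q^TA_QGA_QQ)_{i,j}(UGU^T)_{i,j}(QGQ^T)_{i,j}\\&+(Q^TA_QGA_QQ)_{i,j}G_{i,j}(QUGU^TQ^T)_{i,j}\Big\}\\+2\sum_{i,j=1}^K\Big\{&(Q^TA_QUGA_QQ)_{i,j}(UG)_{j,i}(QGQ^T)_{i,j}+(Q^TA_QUGA_QQ)_{i,j}(QUGQ^T)_{j,i}G_{i,j}\\&+(UG)_{i,j}(QUGQ^T)_{j,i}(Q^TA_QGA_QQ)_{i,j}\Big\},\end{aligned}$$ a quadratic form in the coefficients $U_{i,j}$, $1\le i\le K$, $1\le j\le K-1$. Its determinant is a rational function of the entries of $Q$ and $G$, with denominator $S^{2K(K-1)}$, where $S$ is the trace of the adjugate of $I-Q$, which is positive for irreducible $Q$; let $H(Q,G)$ be its numerator, that is, the determinant times $S^{2K(K-1)}$. Let $Q^\star$ be a $K\times K$ transition matrix and $\pi^\star$ a probability vector such that: [H1] $Q^\star$ has full rank; [H2]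 the Markov chain with transition matrix $Q^\star$ is irreducible and aperiodic; [H3] its initial distribution $\pi^\star$ is stationary. Let $\mathbf f^\star=(f_1^\star,\dots,f_K^\star)$ be probability densities on $\mathcal Y$ which belong to $L^2(\mathcal Y,\mathcal L)$ and such that: [H4] $f_1^\star,\dots,f_K^\star$ are linearly independent. Assume moreover [HD]: $H(Q^\star,G(\mathbf f^\star))\neq0$. For $\mathbf h\in L^2(\mathcal Y,\mathcal L)^K$ let $\|\mathbf h\|_{Q^\star}^2=\min_{\tau\in T_{Q^\star}}\sum_{k=1}^K\|h_k+f_k^\star-f^\star_{\tau(k)}\|_2^2$. Let $\mathcal K$ be a closed bounded subset of $L^2(\mathcal Y,\mathcal L)^K$ such that $\int h_i\,d\mathcal L=0$ for all $\mathbf h\in\mathcal K$ and $i=1,\dots,K$. Let $\mathcal V$ be a compact neighbourhood of $Q^\star$ in the set of transition matrices such that, for all $Q\in\mathcal V$, $H(Q,G(\mathbf f^\star))\ne0$, [H1]–[H3] hold for $Q$ (with its stationary distribution as initial distribution) and $T_Q\subset T_{Q^\star}$. Then there is a constant $c=c(\mathcal K,\mathcal V,\mathbf f^\star)>0$ such that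 $$\|g^{Q,\mathbf f^\star+\mathbf h}-g^{Q,\mathbf f^\star}\|_2\ \ge\ c\,\|\mathbf h\|_{Q^\star}\qquad\text{for all }\mathbf h\in\mathcal K\text{ and all }Q\in\mathcal V.$$ -/

import Mathlib

open MeasureTheory Topology
open scoped Matrix ENNReal

namespace HMM

noncomputable section

/-! ### Finite Markov chains -/

/-- The set of `K × K` transition matrices (real, nonnegative entries, rows summing to one). -/
def transitionMatrices (K : ℕ) : Set (Matrix (Fin K) (Fin K) ℝ) :=
  {Q | Q ∈ Matrix.rowStochastic ℝ (Fin K)}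

/-- `π` is a probability vector which is stationary for `Q`, that is `π Q = π`. -/
def IsStationaryDist {K : ℕ} (Q : Matrix (Fin K) (Fin K) ℝ) (π : Fin K → ℝ) : Prop :=
  π ∈ stdSimplex ℝ (Fin K) ∧ π ᵥ* Q = π

open Classical in
/-- The stationary distribution of `Q` (it is unique when `Q` is irreducible; the value is `0`
when there is no stationary distribution, which does not happen for a transition matrix). -/
def stationaryDist {K : ℕ} (Q : Matrix (Fin K) (Fin K) ℝ) : Fin K → ℝ :=
  if h : ∃ π : Fin K → ℝ, IsStationaryDist Q π then h.choose else 0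

/-- Every state has period one: `1` is the only common divisor of the possible return times. -/
def IsAperiodic {K : ℕ} (Q : Matrix (Fin K) (Fin K) ℝ) : Prop :=
  ∀ i : Fin K, ∀ d : ℕ, (∀ n : ℕ, 0 < n → 0 < (Q ^ n) i i → d ∣ n) → d = 1

/-- The assumptions on the hidden chain with transition matrix `Q` and initial distribution `π`:
`Q` has full rank, the chain is irreducible and aperiodic, and `π` is stationary. -/
structure ChainAssumptions {K : ℕ} (Q : Matrix (Fin K) (Fin K) ℝ) (π : Fin K → ℝ) : Prop where
  transition : Q ∈ transitionMatrices K
  full_rank : Q.rank = K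
  irreducible : Q.IsIrreducible
  aperiodic : IsAperiodic Q
  stationary : IsStationaryDist Q π

/-- The permutations `τ` of the states such that `Q (τ i) (τ j) = Q i j` for all `i`, `j`. -/
def symmPerms {K : ℕ} (Q : Matrix (Fin K) (Fin K) ℝ) : Set (Equiv.Perm (Fin K)) :=
  {τ | ∀ i j, Q (τ i) (τ j) = Q i j}

/-! ### Laws of three consecutive observations -/

/-- The real Hilbert space of square integrable functions on `Y ⊆ ℝ^D`, for Lebesgue measure. -/
abbrev L2 {D : ℕ} (Y : Set (EuclideanSpace ℝ (Fin D))) : Type :=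
  Lp ℝ 2 (volume.restrict Y)

/-- The function
`(y₁, y₂, y₃) ↦ ∑ π(k₁) Q(k₁, k₂) Q(k₂, k₃) f_{k₁}(y₁) f_{k₂}(y₂) f_{k₃}(y₃)`,
where `π` is the stationary distribution of `Q`. -/
def tripleFun {K : ℕ} {E : Type*} (Q : Matrix (Fin K) (Fin K) ℝ) (f : Fin K → E → ℝ) :
    E × E × E → ℝ :=
  fun y => ∑ k₁, ∑ k₂, ∑ k₃, stationaryDist Q k₁ * Q k₁ k₂ * Q k₂ k₃ *
    (f k₁ y.1 * f k₂ y.2.1 * f k₃ y.2.2)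

/-- The function `tripleFun` for (representatives of) a family of elements of `L²(Y)`. -/
def g {K D : ℕ} {Y : Set (EuclideanSpace ℝ (Fin D))} (Q : Matrix (Fin K) (Fin K) ℝ)
    (f : Fin K → L2 Y) :
    EuclideanSpace ℝ (Fin D) × EuclideanSpace ℝ (Fin D) × EuclideanSpace ℝ (Fin D) → ℝ :=
  tripleFun Q (fun k => (f k : EuclideanSpace ℝ (Fin D) → ℝ))

/-- The `L²` norm of a function on `Y × Y × Y` for Lebesgue measure. -/
def norm3 {D : ℕ} (Y : Set (EuclideanSpace ℝ (Fin D)))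
    (u : EuclideanSpace ℝ (Fin D) × EuclideanSpace ℝ (Fin D) × EuclideanSpace ℝ (Fin D) → ℝ) :
    ℝ :=
  (eLpNorm u 2 ((volume.restrict Y).prod
    ((volume.restrict Y).prod (volume.restrict Y)))).toReal

/-- `‖h‖_Q`, the square root of
`min {∑ₖ ‖hₖ + fₖ - f_{τ(k)}‖² : τ a permutation with Q(τ i, τ j) = Q(i, j) for all i, j}`;
the infimum is over a finite nonempty set. -/
def permNorm {K D : ℕ} {Y : Set (EuclideanSpace ℝ (Fin D))} (Q : Matrix (Fin K) (Fin K) ℝ)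
    (f h : Fin K → L2 Y) : ℝ :=
  Real.sqrt (⨅ τ : symmPerms Q, ∑ k, ‖h k + f k - f (τ.1 k)‖ ^ 2)

/-! ### The quadratic form and its determinant -/

/-- The quadratic form `U ↦ 𝒟(U)`, with `G` a Gram matrix and `A` the diagonal matrix of the
stationary distribution of `Q`. -/
def quadD {K : ℕ} (Q G U : Matrix (Fin K) (Fin K) ℝ) : ℝ :=
  let A : Matrix (Fin K) (Fin K) ℝ := Matrix.diagonal (stationaryDist Q)
  (∑ i, ∑ j,
    ((Qᵀ * A * U * G * Uᵀ * A * Q) i j * G i j * (Q * G * Qᵀ) i j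
      + (Qᵀ * A * G * A * Q) i j * (U * G * Uᵀ) i j * (Q * G * Qᵀ) i j
      + (Qᵀ * A * G * A * Q) i j * G i j * (Q * U * G * Uᵀ * Qᵀ) i j))
  + 2 * ∑ i, ∑ j,
    ((Qᵀ * A * U * G * A * Q) i j * (U * G) j i * (Q * G * Qᵀ) i j
      + (Qᵀ * A * U * G * A * Q) i j * (Q * U * G * Qᵀ) j i * G i j
      + (U * G) i j * (Q * U * G * Qᵀ) j i * (Qᵀ * A * G * A * Q) i j)

/-- The index set `{(i, j) : 1 ≤ i ≤ K, 1 ≤ j ≤ K - 1}` of the free coefficients of a matrix `U`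
with zero row sums. -/
abbrev FreeIndex (K : ℕ) : Type := Fin K × {j : Fin K // j.val + 1 < K}

/-- The matrix `U` with zero row sums whose free coefficient at `a` is one and whose other free
coefficients are zero. -/
def basisU {K : ℕ} (a : FreeIndex K) : Matrix (Fin K) (Fin K) ℝ :=
  Matrix.of fun i j =>
    if i = a.1 then (if j = a.2.1 then 1 else if j.val + 1 = K then -1 else 0) else 0

/-- The determinant of the quadratic form `𝒟` in the free coefficients of `U`, that is, of the
symmetric matrix that represents it. -/
def detD {K : ℕ} (Q G : Matrix (Fin K) (Fin K) ℝ) : ℝ :=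
  Matrix.det (Matrix.of fun a b : FreeIndex K =>
    (quadD Q G (basisU a + basisU b) - quadD Q G (basisU a) - quadD Q G (basisU b)) / 2)

/-- `H(Q, G)`, the numerator of the determinant of `𝒟`. For an irreducible transition matrix `Q`
the stationary distribution is `πₖ = Cₖ / S`, where `Cₖ` is the `k`-th principal cofactor of
`1 - Q` and `S = ∑ₖ Cₖ > 0` is the trace of the adjugate. Each coefficient of `𝒟` is homogeneous
of degree two in `π`, so the determinant, of size `K (K - 1)`, is a polynomial in the entries of
`Q` and `G` divided by `S ^ (2 K (K - 1))`; the value below is that polynomial. -/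
def H {K : ℕ} (Q G : Matrix (Fin K) (Fin K) ℝ) : ℝ :=
  detD Q G * (Matrix.trace (1 - Q).adjugate) ^ (2 * (K * (K - 1)))

end

end HMM

/-!
Contract the tensor `∑ π(k₁) Q(k₁, k₂) Q(k₂, k₃) f_{k₁} ⊗ f_{k₂} ⊗ f_{k₃}` in its first and third
factors with test vectors. A left test vector dual to the family `f` isolates one state `r` of `f`
in the middle factor, a right test vector dual to the family `F` isolates one state `s` of `F`, and
comparing the two contractions of the two tensors gives `w · ‖F s - f r‖ ≤ C · ε`, where `ε` is the
distance of the tensors and `w` a weight that depends on the test vectors.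

At parameters where the tensors of `f` and `F` agree, this identity forces the matrix of the
coordinates of `F` to be the matrix of a permutation `τ` that is a symmetry of `Q`; with
`r = τ s` the weight is then `1`, so that the estimate holds, with some constant, for all nearby
parameters. At parameters where the tensors differ, `ε` is bounded below nearby and the estimate
follows from boundedness of the families. Since only finitely many coordinates of `F` enter, the
parameters range over a compact set, and one constant serves all of them.
-/

namespace HMM

open Filter

noncomputable section

theorem mulVec_apply_perm {ι R : Type*} [Fintype ι] [NonUnitalNonAssocSemiring R]
    {Q : Matrix ι ι R} {τ : Equiv.Perm ι} (hτ : ∀ i j, Q (τ i) (τ j) = Q i j) (z : ι → R) (s : ι) :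
    (Q *ᵥ z) (τ s) = (Q *ᵥ (z ∘ τ)) s :=
  (Equiv.sum_comp τ fun j => Q (τ s) j * z j).symm.trans <|
    Finset.sum_congr rfl fun j _ => by rw [hτ, Function.comp_apply]

section TripleForm

variable {ι R : Type*} [Fintype ι] [CommRing R]

/-- The trilinear form `∑ π k₁ * Q k₁ k₂ * Q k₂ k₃ * (x k₁ * y k₂ * z k₃)`, with the sum over the
middle state outermost, so that the three states are coupled only through the two vectors
`(π * x) ᵥ* Q` and `Q *ᵥ z`. -/
def tripleForm (Q : Matrix ι ι R) (π x y z : ι → R) : R :=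
  ((π * x) ᵥ* Q) ⬝ᵥ (y * (Q *ᵥ z))

theorem tripleForm_eq_sum (Q : Matrix ι ι R) (π x y z : ι → R) :
    tripleForm Q π x y z =
      ∑ k₁, ∑ k₂, ∑ k₃, π k₁ * Q k₁ k₂ * Q k₂ k₃ * (x k₁ * y k₂ * z k₃) := by
  rw [Finset.sum_comm]
  simp only [tripleForm, dotProduct, Matrix.vecMul, Matrix.mulVec, Pi.mul_apply, Finset.mul_sum,
    Finset.sum_mul]
  refine Finset.sum_congr rfl fun k₂ _ => ?_
  rw [Finset.sum_comm]
  refine Finset.sum_congr rfl fun k₁ _ => Finset.sum_congr rfl fun k₃ _ => ?_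
  ring

variable [DecidableEq ι] {Q : Matrix ι ι R} {π x z : ι → R} {r s : ι}

theorem tripleForm_of_vecMul_eq_single (hx : (π * x) ᵥ* Q = Pi.single r 1) (y z : ι → R) :
    tripleForm Q π x y z = y r * (Q *ᵥ z) r := by
  simp [tripleForm, hx]

theorem tripleForm_of_mulVec_eq_single (hz : Q *ᵥ z = Pi.single s 1) (π x y : ι → R) :
    tripleForm Q π x y z = ((π * x) ᵥ* Q) s * y s := by
  simp [tripleForm, hz, dotProduct, Pi.single_apply]

theorem tripleForm_single_left (hQ : Q *ᵥ 1 = 1) (π : ι → R) (i : ι) (y : ι → R) :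
    tripleForm Q π (Pi.single i 1) y 1 = π i * (Q *ᵥ y) i := by
  have hπ : π * Pi.single i 1 = Pi.single i (π i) := by
    ext j
    obtain rfl | hj := eq_or_ne j i <;> simp [*]
  rw [tripleForm, hQ, mul_one, ← Matrix.dotProduct_mulVec, hπ, single_dotProduct]

/-- The vector `x` isolates the state `r` in the second form and `z'` the state `s` in the first.
The weights that remain, `(Q *ᵥ z) r` and `((π * x') ᵥ* Q) s`, differ by the difference of the forms
at `y = y' = 1`. -/
theorem mulVec_mul_sub_eq_tripleForm_sub (hx : (π * x) ᵥ* Q = Pi.single r 1) {z' : ι → R}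
    (hz' : Q *ᵥ z' = Pi.single s 1) (x' y y' z : ι → R) :
    (Q *ᵥ z) r * (y' s - y r) =
      (tripleForm Q π x' y' z' - tripleForm Q π x y z) -
        (tripleForm Q π x' 1 z' - tripleForm Q π x 1 z) * y' s := by
  simp only [tripleForm_of_vecMul_eq_single hx, tripleForm_of_mulVec_eq_single hz', Pi.one_apply]
  ring

end TripleForm

section Identifiability

variable {ι 𝕜 : Type*} [Fintype ι] [Field 𝕜] {Q U : Matrix ι ι 𝕜} {π : ι → 𝕜}

/-- Substitution by `U` preserves the trilinear form of `Q` and `π`. -/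
def PreservesTripleForm (Q : Matrix ι ι 𝕜) (π : ι → 𝕜) (U : Matrix ι ι 𝕜) : Prop :=
  ∀ x y z, tripleForm Q π (U *ᵥ x) (U *ᵥ y) (U *ᵥ z) = tripleForm Q π x y z

theorem PreservesTripleForm.apply_perm_perm_eq {τ : Equiv.Perm ι} (hU : PreservesTripleForm Q π U)
    (hτ : ∀ y, U *ᵥ y = y ∘ τ) (hQ1 : Q *ᵥ 1 = 1) (hπ : ∀ i, π i ≠ 0) (i j : ι) :
    Q (τ i) (τ j) = Q i j := by
  classical
  have hsingle : ∀ k, (Pi.single (τ k) 1 : ι → 𝕜) ∘ τ = Pi.single k 1 := fun k => by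
    ext l; simp [Pi.single_apply]
  have hrow : ∀ y, π i * (Q *ᵥ (y ∘ τ)) i = π (τ i) * (Q *ᵥ y) (τ i) := fun y => by
    have h := hU (Pi.single (τ i) 1) y 1
    rwa [hτ, hτ, hτ, hsingle, Pi.one_comp, tripleForm_single_left hQ1,
      tripleForm_single_left hQ1] at h
  have hπτ : π i = π (τ i) := by simpa [hQ1] using hrow 1
  have h := hrow (Pi.single (τ j) 1)
  rw [hsingle, ← hπτ] at h
  simpa using (mul_left_cancel₀ (hπ i) h).symm

variable [DecidableEq ι]

theorem vecMul_inv_row_div_eq_single (hQ : Q.det ≠ 0) (hπ : ∀ i, π i ≠ 0) (r : ι) :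
    (π * (Q⁻¹.row r / π)) ᵥ* Q = Pi.single r 1 := by
  have hcancel : π * (Q⁻¹.row r / π) = Q⁻¹.row r := funext fun i => mul_div_cancel₀ _ (hπ i)
  rw [hcancel, ← Matrix.single_one_vecMul, Matrix.vecMul_vecMul,
    Matrix.nonsing_inv_mul _ hQ.isUnit, Matrix.vecMul_one]

theorem mulVec_inv_col_eq_single (hQ : Q.det ≠ 0) (s : ι) :
    Q *ᵥ Q⁻¹.col s = Pi.single s 1 := by
  rw [← Matrix.mulVec_single_one, Matrix.mulVec_mulVec, Matrix.mul_nonsing_inv _ hQ.isUnit,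
    Matrix.one_mulVec]

namespace PreservesTripleForm

theorem det_ne_zero (hU : PreservesTripleForm Q π U) (hQ : Q.det ≠ 0) (hπ : ∀ i, π i ≠ 0) :
    U.det ≠ 0 := by
  intro hdet
  obtain ⟨z, hz0, hz⟩ := Matrix.exists_mulVec_eq_zero_iff.2 hdet
  refine hz0 (Matrix.eq_zero_of_mulVec_eq_zero hQ (funext fun r => ?_))
  have h := hU (Q⁻¹.row r / π) 1 z
  rw [tripleForm_of_vecMul_eq_single (vecMul_inv_row_div_eq_single hQ hπ r), hz] at h
  simpa [tripleForm] using h.symm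

theorem exists_forall_mulVec_apply_eq (hU : PreservesTripleForm Q π U) (hU1 : U *ᵥ 1 = 1)
    (hQ : Q.det ≠ 0) (hπ : ∀ i, π i ≠ 0) (s : ι) : ∃ r, ∀ y, (U *ᵥ y) s = y r := by
  have hQU : (Q * U).det ≠ 0 := by
    rw [Matrix.det_mul]
    exact mul_ne_zero hQ (hU.det_ne_zero hQ hπ)
  set z := (Q * U)⁻¹.col s
  have hz : Q *ᵥ (U *ᵥ z) = Pi.single s 1 := by
    rw [Matrix.mulVec_mulVec, mulVec_inv_col_eq_single hQU]
  have hQz : Q *ᵥ z ≠ 0 := fun h => by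
    simpa [Matrix.eq_zero_of_mulVec_eq_zero hQ h] using congrFun hz s
  obtain ⟨r, hr⟩ := Function.ne_iff.1 hQz
  refine ⟨r, fun y => sub_eq_zero.1 ((mul_eq_zero.1 ?_).resolve_left hr)⟩
  set x := Q⁻¹.row r / π
  have hone := hU x 1 z
  rw [hU1] at hone
  rw [mulVec_mul_sub_eq_tripleForm_sub (vecMul_inv_row_div_eq_single hQ hπ r) hz (U *ᵥ x),
    hU, hone, sub_self, sub_self, zero_mul, sub_zero]

theorem exists_perm_mulVec_eq_comp (hU : PreservesTripleForm Q π U) (hU1 : U *ᵥ 1 = 1)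
    (hQ : Q.det ≠ 0) (hπ : ∀ i, π i ≠ 0) : ∃ τ : Equiv.Perm ι, ∀ y, U *ᵥ y = y ∘ τ := by
  choose σ hσ using hU.exists_forall_mulVec_apply_eq hU1 hQ hπ
  have hcomp : U.mulVec = fun y => y ∘ σ := funext fun y => funext fun s => hσ s y
  have hinj : Function.Injective U.mulVec := Matrix.mulVec_injective_iff_isUnit.2 <|
    (Matrix.isUnit_iff_isUnit_det U).2 (hU.det_ne_zero hQ hπ).isUnit
  have hsurj : Function.Surjective σ :=
    Function.injective_comp_right_iff_surjective.1 (hcomp ▸ hinj)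
  exact ⟨Equiv.ofBijective σ (Finite.surjective_iff_bijective.1 hsurj), congrFun hcomp⟩

end PreservesTripleForm

end Identifiability

section Stability

variable {ι E : Type*} [NormedAddCommGroup E] [InnerProductSpace ℝ E]

theorem exists_inner_section [Finite ι] [Nonempty ι] {f : ι → E}
    (hf : LinearIndependent ℝ f) {e : E} (he : ∀ k, inner ℝ (f k) e = 1) :
    ∃ D : (ι → ℝ) →ₗ[ℝ] E, (∀ k x, inner ℝ (f k) (D x) = x k) ∧ D 1 = e := by
  classical
  cases nonempty_fintype ι
  set G := Matrix.gram ℝ f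
  have hG : IsUnit G.det := (Matrix.posDef_gram_of_linearIndependent hf).det_pos.ne'.isUnit
  let D₀ : (ι → ℝ) →ₗ[ℝ] E := Fintype.linearCombination ℝ f ∘ₗ G⁻¹.mulVecLin
  have hD₀ : ∀ k x, inner ℝ (f k) (D₀ x) = x k := by
    intro k x
    have hGx : (G *ᵥ (G⁻¹ *ᵥ x)) k = x k := by
      rw [Matrix.mulVec_mulVec, Matrix.mul_nonsing_inv _ hG, Matrix.one_mulVec]
    rw [← hGx]
    simp [D₀, G, Fintype.linearCombination_apply, inner_sum, inner_smul_right, Matrix.mulVec,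
      dotProduct, mul_comm]
  let i := Classical.arbitrary ι
  refine ⟨D₀ + (LinearMap.proj i).smulRight (e - D₀ 1), fun k x => ?_, by simp⟩
  simp [inner_add_right, inner_smul_right, inner_sub_right, hD₀, he]

variable [Fintype ι]

/-- The pairing with `u ⊗ v ⊗ w` of the tensor `∑ π k₁ Q k₁ k₂ Q k₂ k₃ F k₁ ⊗ F k₂ ⊗ F k₃`. -/
def tensorForm (Q : Matrix ι ι ℝ) (π : ι → ℝ) (F : ι → E) (u v w : E) : ℝ :=
  tripleForm Q π (fun k => inner ℝ (F k) u) (fun k => inner ℝ (F k) v) fun k => inner ℝ (F k) w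

/-- The injective norm of the difference of the tensors of the families `F` and `f` is at most
`ε`. -/
def TensorDistLE (Q : Matrix ι ι ℝ) (π : ι → ℝ) (F f : ι → E) (ε : ℝ) : Prop :=
  ∀ u v w, |tensorForm Q π F u v w - tensorForm Q π f u v w| ≤ ε * (‖u‖ * ‖v‖ * ‖w‖)

theorem TensorDistLE.mulVec_mul_norm_sub_le [DecidableEq ι] {Q : Matrix ι ι ℝ} {π : ι → ℝ}
    {F f : ι → E} {ε : ℝ} (h : TensorDistLE Q π F f ε) (hε : 0 ≤ ε) {e : E}
    (hF : ∀ k, inner ℝ (F k) e = 1) (hf : ∀ k, inner ℝ (f k) e = 1) {u v : E} {r s : ι}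
    (hu : (π * fun k => inner ℝ (f k) u) ᵥ* Q = Pi.single r 1)
    (hv : Q *ᵥ (fun k => inner ℝ (F k) v) = Pi.single s 1) :
    (Q *ᵥ fun k => inner ℝ (f k) v) r * ‖F s - f r‖ ≤
      ‖u‖ * ‖v‖ * (1 + ‖e‖ * ‖F s‖) * ε := by
  set w := F s - f r with hw
  rcases (norm_nonneg w).eq_or_lt with h0 | h0
  · rw [← h0, mul_zero]
    positivity
  refine le_of_mul_le_mul_right ?_ h0
  have hgap := mulVec_mul_sub_eq_tripleForm_sub hu hv (fun k => inner ℝ (F k) u)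
    (fun k => inner ℝ (f k) w) (fun k => inner ℝ (F k) w) (fun k => inner ℝ (f k) v)
  rw [← inner_sub_left, ← hw, real_inner_self_eq_norm_sq] at hgap
  have hwdist := h u w v
  have hedist := h u e v
  simp only [tensorForm, hF, hf] at hwdist hedist
  have hFw : |inner ℝ (F s) w| ≤ ‖F s‖ * ‖w‖ := abs_real_inner_le_norm _ _
  calc (Q *ᵥ fun k => inner ℝ (f k) v) r * ‖w‖ * ‖w‖
      = _ := by rw [mul_assoc, ← sq, hgap]
    _ ≤ ε * (‖u‖ * ‖w‖ * ‖v‖) + ε * (‖u‖ * ‖e‖ * ‖v‖) * (‖F s‖ * ‖w‖) := by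
      refine (le_abs_self _).trans ((abs_sub _ _).trans (add_le_add hwdist ?_))
      rw [abs_mul]
      exact mul_le_mul hedist hFw (abs_nonneg _) (by positivity)
    _ = ‖u‖ * ‖v‖ * (1 + ‖e‖ * ‖F s‖) * ε * ‖w‖ := by ring

/-- The data that vary in the stability estimate: the transition matrix, its stationary distribution
and the coordinates of the perturbed family in the original one. -/
abbrev Params (ι : Type*) : Type _ := Matrix ι ι ℝ × (ι → ℝ) × Matrix ι ι ℝ

/-- Every family `F` bounded by `B`, with coordinates `U` along the section `D`, whose tensor is
within `ε` of that of `f`, is within `C * ε` of `f` up to a permutation in `T`; here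
`p = (Q, π, U)`. -/
def IsStableAt (f : ι → E) (D : (ι → ℝ) →ₗ[ℝ] E) (T : Set (Equiv.Perm ι)) (B C : ℝ)
    (p : Params ι) : Prop :=
  ∀ F : ι → E, (∀ k, inner ℝ (F k) (D 1) = 1) → (∀ k, ‖F k‖ ≤ B) →
    (∀ x, (fun k => inner ℝ (F k) (D x)) = p.2.2 *ᵥ x) → ∀ ε, 0 ≤ ε →
    TensorDistLE p.1 p.2.1 F f ε → ∃ τ ∈ T, ∀ s, ‖F s - f (τ s)‖ ≤ C * ε

theorem eventually_le_of_continuousAt {X : Type*} [TopologicalSpace X] {c : X → ℝ} {x : X}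
    (hc : ContinuousAt c x) : ∀ᶠ q : ℝ × X in atTop ×ˢ 𝓝 x, c q.2 ≤ q.1 := by
  filter_upwards [(eventually_ge_atTop (c x + 1)).prod_inl _,
    (hc.eventually_lt_const (lt_add_one (c x))).prod_inr _] with q hC hq
  exact hq.le.trans hC

variable {f : ι → E} {D : (ι → ℝ) →ₗ[ℝ] E} {T : Set (Equiv.Perm ι)} {p₀ : Params ι}

theorem eventually_isStableAt_of_not_preserves (hD : ∀ k x, inner ℝ (f k) (D x) = x k)
    (hT : 1 ∈ T) (B : ℝ) (hp₀ : ¬ PreservesTripleForm p₀.1 p₀.2.1 p₀.2.2) :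
    ∀ᶠ q in atTop ×ˢ 𝓝 p₀, IsStableAt f D T B q.1 q.2 := by
  simp only [PreservesTripleForm, not_forall] at hp₀
  obtain ⟨x, y, z, hne⟩ := hp₀
  let δ : Params ι → ℝ := fun p =>
    tripleForm p.1 p.2.1 (p.2.2 *ᵥ x) (p.2.2 *ᵥ y) (p.2.2 *ᵥ z) - tripleForm p.1 p.2.1 x y z
  have hδ : Continuous δ := by
    unfold δ tripleForm
    fun_prop
  have hδ₀ : δ p₀ ≠ 0 := sub_ne_zero.2 hne
  have hc : ContinuousAt (fun p => (B + ‖f‖) * (‖D x‖ * ‖D y‖ * ‖D z‖) / |δ p|) p₀ :=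
    continuousAt_const.div hδ.abs.continuousAt (abs_ne_zero.2 hδ₀)
  filter_upwards [eventually_le_of_continuousAt hc,
    (hδ.continuousAt.eventually_ne hδ₀).prod_inr _] with ⟨C, p⟩ hC hδp F _ hFB hFU ε hε h
  refine ⟨1, hT, fun s => ?_⟩
  have hgap : |δ p| ≤ ε * (‖D x‖ * ‖D y‖ * ‖D z‖) := by
    simpa only [tensorForm, hFU, hD] using h (D x) (D y) (D z)
  have hnorm : ‖F s - f s‖ ≤ B + ‖f‖ :=
    (norm_sub_le _ _).trans (add_le_add (hFB s) (norm_le_pi_norm f s))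
  refine hnorm.trans (le_trans ?_ (mul_le_mul_of_nonneg_right hC hε))
  rw [div_mul_eq_mul_div, le_div_iff₀ (abs_pos.2 hδp), mul_assoc, mul_comm _ ε]
  exact mul_le_mul_of_nonneg_left hgap ((norm_nonneg _).trans hnorm)

variable [DecidableEq ι]

theorem continuousAt_nonsing_inv {X : Type*} [TopologicalSpace X] {A : X → Matrix ι ι ℝ} {x : X}
    (hA : ContinuousAt A x) (h : (A x).det ≠ 0) : ContinuousAt (fun p => (A p)⁻¹) x := by
  refine ContinuousAt.comp (g := Inv.inv) (continuousAt_matrix_inv _ ?_) hA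
  rw [Ring.inverse_eq_inv']
  exact continuousAt_inv₀ h

theorem continuousAt_inv_row_div {Q : Matrix ι ι ℝ} {π : ι → ℝ} (hQ : Q.det ≠ 0)
    (hπ : ∀ i, π i ≠ 0) (U : Matrix ι ι ℝ) (r : ι) :
    ContinuousAt (fun p : Params ι => p.1⁻¹.row r / p.2.1) (Q, π, U) := by
  refine continuousAt_pi.2 fun i => ContinuousAt.div ?_ (by fun_prop) (hπ i)
  exact (continuous_id.matrix_elem r i).continuousAt.comp
    (continuousAt_nonsing_inv continuousAt_fst hQ)

theorem continuousAt_inv_mul_col {Q U : Matrix ι ι ℝ} (hQU : (Q * U).det ≠ 0) (π : ι → ℝ) (s : ι) :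
    ContinuousAt (fun p : Params ι => (p.1 * p.2.2)⁻¹.col s) (Q, π, U) := by
  refine continuousAt_pi.2 fun i => ?_
  exact (continuous_id.matrix_elem i s).continuousAt.comp
    (continuousAt_nonsing_inv (A := fun p : Params ι => p.1 * p.2.2) (by fun_prop) hQU)

/-- The weight of `y' s - y r` in `mulVec_mul_sub_eq_tripleForm_sub` for the right test vector that
isolates the state `s` of the family with coordinates `U`, where `p = (Q, π, U)`. -/
def gapWeight (r s : ι) (p : Params ι) : ℝ := (p.1 *ᵥ (p.1 * p.2.2)⁻¹.col s) r

/-- The factor of `ε` in the bound on `‖F s - f r‖` for a family `F` with coordinates `U`, where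
`p = (Q, π, U)`, that `TensorDistLE.mulVec_mul_norm_sub_le` gives after division by the weight. The
value is a junk `0` where the weight vanishes. -/
def stabilityConst (D : (ι → ℝ) →ₗ[ℝ] E) (B : ℝ) (r s : ι) (p : Params ι) : ℝ :=
  ‖D (p.1⁻¹.row r / p.2.1)‖ * ‖D ((p.1 * p.2.2)⁻¹.col s)‖ * (1 + ‖D 1‖ * B) / gapWeight r s p

theorem norm_sub_le_stabilityConst (hD : ∀ k x, inner ℝ (f k) (D x) = x k) {Q U : Matrix ι ι ℝ}
    {π : ι → ℝ} (hQ : Q.det ≠ 0) (hQU : (Q * U).det ≠ 0) (hπ : ∀ i, π i ≠ 0) {r s : ι}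
    (hweight : 0 < gapWeight r s (Q, π, U)) {F : ι → E} (hF : ∀ k, inner ℝ (F k) (D 1) = 1)
    {B : ℝ} (hB : ‖F s‖ ≤ B) (hFU : ∀ x, (fun k => inner ℝ (F k) (D x)) = U *ᵥ x) {ε : ℝ}
    (hε : 0 ≤ ε) (h : TensorDistLE Q π F f ε) :
    ‖F s - f r‖ ≤ stabilityConst D B r s (Q, π, U) * ε := by
  have hu : (π * fun k => inner ℝ (f k) (D (Q⁻¹.row r / π))) ᵥ* Q = Pi.single r 1 := by
    simp only [hD]
    exact vecMul_inv_row_div_eq_single hQ hπ r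
  have hv : Q *ᵥ (fun k => inner ℝ (F k) (D ((Q * U)⁻¹.col s))) = Pi.single s 1 := by
    rw [hFU, Matrix.mulVec_mulVec]
    exact mulVec_inv_col_eq_single hQU s
  have hkey := h.mulVec_mul_norm_sub_le hε hF (fun k => hD k 1) hu hv
  simp only [hD] at hkey
  rw [stabilityConst, div_mul_eq_mul_div, le_div_iff₀ hweight, mul_comm]
  refine hkey.trans ?_
  gcongr

theorem continuousAt_gapWeight {Q U : Matrix ι ι ℝ} (hQU : (Q * U).det ≠ 0) (π : ι → ℝ)
    (r s : ι) : ContinuousAt (gapWeight r s) (Q, π, U) := by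
  have hmulVec : Continuous fun a : Matrix ι ι ℝ × (ι → ℝ) => (a.1 *ᵥ a.2) r := by fun_prop
  exact hmulVec.continuousAt.comp (continuousAt_fst.prodMk (continuousAt_inv_mul_col hQU π s))

theorem continuousAt_stabilityConst (D : (ι → ℝ) →ₗ[ℝ] E) (B : ℝ) {Q U : Matrix ι ι ℝ}
    {π : ι → ℝ} (hQ : Q.det ≠ 0) (hQU : (Q * U).det ≠ 0) (hπ : ∀ i, π i ≠ 0) {r s : ι}
    (hweight : gapWeight r s (Q, π, U) ≠ 0) : ContinuousAt (stabilityConst D B r s) (Q, π, U) := by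
  have hDcont : Continuous D := D.continuous_of_finiteDimensional
  have hu := hDcont.continuousAt.comp (continuousAt_inv_row_div hQ hπ U r)
  have hv := hDcont.continuousAt.comp (continuousAt_inv_mul_col hQU π s)
  exact ((hu.norm.mul hv.norm).mul continuousAt_const).div (continuousAt_gapWeight hQU π r s)
    hweight

theorem gapWeight_perm_eq_one {Q U : Matrix ι ι ℝ} {τ : Equiv.Perm ι} (hQU : (Q * U).det ≠ 0)
    (hτ : ∀ y, U *ᵥ y = y ∘ τ) (hτQ : ∀ i j, Q (τ i) (τ j) = Q i j) (π : ι → ℝ) (s : ι) :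
    gapWeight (τ s) s (Q, π, U) = 1 := by
  rw [gapWeight, mulVec_apply_perm hτQ, ← hτ, Matrix.mulVec_mulVec, mulVec_inv_col_eq_single hQU,
    Pi.single_eq_same]

theorem eventually_isStableAt_of_preserves (hD : ∀ k x, inner ℝ (f k) (D x) = x k)
    {Q U : Matrix ι ι ℝ} {π : ι → ℝ} (hU : PreservesTripleForm Q π U) (hU1 : U *ᵥ 1 = 1)
    (hQ : Q.det ≠ 0) (hQ1 : Q *ᵥ 1 = 1) (hπ : ∀ i, π i ≠ 0)
    (hT : ∀ τ : Equiv.Perm ι, (∀ i j, Q (τ i) (τ j) = Q i j) → τ ∈ T) (B : ℝ) :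
    ∀ᶠ q in atTop ×ˢ 𝓝 (Q, π, U), IsStableAt f D T B q.1 q.2 := by
  obtain ⟨τ, hτ⟩ := hU.exists_perm_mulVec_eq_comp hU1 hQ hπ
  have hτQ := hU.apply_perm_perm_eq hτ hQ1 hπ
  have hQU : (Q * U).det ≠ 0 := by
    rw [Matrix.det_mul]
    exact mul_ne_zero hQ (hU.det_ne_zero hQ hπ)
  have hweight := gapWeight_perm_eq_one hQU hτ hτQ π
  have hconst : ∀ s, ContinuousAt (stabilityConst D B (τ s) s) (Q, π, U) := fun s =>
    continuousAt_stabilityConst D B hQ hQU hπ (by simp [hweight])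
  have hQ_near : ∀ᶠ p : Params ι in 𝓝 (Q, π, U), p.1.det ≠ 0 :=
    ContinuousAt.eventually_ne (by fun_prop) hQ
  have hQU_near : ∀ᶠ p : Params ι in 𝓝 (Q, π, U), (p.1 * p.2.2).det ≠ 0 :=
    ContinuousAt.eventually_ne (by fun_prop) hQU
  have hπ_near : ∀ᶠ p : Params ι in 𝓝 (Q, π, U), ∀ i, p.2.1 i ≠ 0 :=
    eventually_all.2 fun i => ContinuousAt.eventually_ne (by fun_prop) (hπ i)
  have hweight_near : ∀ᶠ p in 𝓝 (Q, π, U), ∀ s, 0 < gapWeight (τ s) s p :=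
    eventually_all.2 fun s =>
      (continuousAt_gapWeight hQU π (τ s) s).eventually_const_lt (by simp [hweight])
  filter_upwards [eventually_all.2 fun s => eventually_le_of_continuousAt (hconst s),
    hQ_near.prod_inr _, hQU_near.prod_inr _, hπ_near.prod_inr _, hweight_near.prod_inr _]
    with ⟨C, p⟩ hC hQp hQUp hπp hweightp F hF hFB hFU ε hε h
  refine ⟨τ, hT τ hτQ, fun s => ?_⟩
  calc ‖F s - f (τ s)‖ ≤ stabilityConst D B (τ s) s p * ε :=
        norm_sub_le_stabilityConst hD hQp hQUp hπp (hweightp s) hF (hFB s) hFU hε h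
    _ ≤ C * ε := mul_le_mul_of_nonneg_right (hC s) hε

theorem exists_forall_isStableAt (hD : ∀ k x, inner ℝ (f k) (D x) = x k) {S : Set (Params ι)}
    (hS : IsCompact S) (hU1 : ∀ p ∈ S, p.2.2 *ᵥ 1 = 1) (hQ : ∀ p ∈ S, p.1.det ≠ 0)
    (hQ1 : ∀ p ∈ S, p.1 *ᵥ 1 = 1) (hπ : ∀ p ∈ S, ∀ i, p.2.1 i ≠ 0)
    (hT : ∀ p ∈ S, ∀ τ : Equiv.Perm ι, (∀ i j, p.1 (τ i) (τ j) = p.1 i j) → τ ∈ T) (B : ℝ) :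
    ∃ C > 0, ∀ p ∈ S, IsStableAt f D T B C p := by
  have hlocal : ∀ p ∈ S, ∀ᶠ q in atTop ×ˢ 𝓝 p, IsStableAt f D T B q.1 q.2 := fun p hp => by
    by_cases hU : PreservesTripleForm p.1 p.2.1 p.2.2
    · exact eventually_isStableAt_of_preserves hD hU (hU1 p hp) (hQ p hp) (hQ1 p hp) (hπ p hp)
        (hT p hp) B
    · exact eventually_isStableAt_of_not_preserves hD (hT p hp 1 fun _ _ => rfl) B hU
  have hglobal : ∀ᶠ q in atTop ×ˢ 𝓝ˢ S, IsStableAt f D T B q.1 q.2 :=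
    hS.mem_prod_nhdsSet_of_forall hlocal
  obtain ⟨C, hC, hC0⟩ := (hglobal.curry.and (eventually_gt_atTop 0)).exists
  exact ⟨C, hC0, hC.self_of_nhdsSet⟩

end Stability

section Chain

theorem det_ne_zero_of_rank_eq_card {ι 𝕜 : Type*} [Fintype ι] [DecidableEq ι] [Field 𝕜]
    {A : Matrix ι ι 𝕜} (hA : A.rank = Fintype.card ι) : A.det ≠ 0 := by
  have hcol : LinearIndependent 𝕜 A.col := by
    rw [linearIndependent_iff_card_eq_finrank_span, Set.finrank,
      ← Matrix.rank_eq_finrank_span_cols, hA]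
  exact ((Matrix.isUnit_iff_isUnit_det A).1
    (Matrix.linearIndependent_cols_iff_isUnit.1 hcol)).ne_zero

theorem pos_of_vecMul_eq_self {ι : Type*} [Fintype ι] {A : Matrix ι ι ℝ}
    {π : ι → ℝ} (hA : A.IsIrreducible) (hπ : 0 < π) (hst : π ᵥ* A = π) (j : ι) : 0 < π j := by
  classical
  obtain ⟨hπ0, i, hi⟩ := Pi.lt_def.1 hπ
  obtain ⟨n, -, hn⟩ := (Matrix.isIrreducible_iff_exists_pow_pos hA.nonneg).1 hA i j
  have hpow : ∀ n : ℕ, π ᵥ* A ^ n = π := fun n => by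
    induction n with
    | zero => rw [pow_zero, Matrix.vecMul_one]
    | succ n ih => rw [pow_succ, ← Matrix.vecMul_vecMul, ih, hst]
  rw [← hpow n]
  exact Finset.sum_pos' (fun m _ => mul_nonneg (hπ0 m) (Matrix.pow_apply_nonneg hA.nonneg n m j))
    ⟨i, Finset.mem_univ i, mul_pos hi hn⟩

variable {K : ℕ}

theorem IsStationaryDist.pos {Q : Matrix (Fin K) (Fin K) ℝ} {π : Fin K → ℝ}
    (hπ : IsStationaryDist Q π) (hQ : Q.IsIrreducible) (j : Fin K) : 0 < π j := by
  obtain ⟨⟨hπ0, hπsum⟩, hst⟩ := hπ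
  refine pos_of_vecMul_eq_self hQ (lt_of_le_of_ne hπ0 fun h => ?_) hst j
  simp [← h] at hπsum

/-- The parameters `(Q, π, U)` with `Q` in `𝒱`, `π` stationary for `Q` and `U` a matrix with unit
row sums and entries bounded by `b`. -/
def stationaryParams (𝒱 : Set (Matrix (Fin K) (Fin K) ℝ)) (b : ℝ) : Set (Params (Fin K)) :=
  {p | p.1 ∈ 𝒱 ∧ IsStationaryDist p.1 p.2.1 ∧ (∀ i j, |p.2.2 i j| ≤ b) ∧ p.2.2 *ᵥ 1 = 1}

theorem isCompact_stationaryParams {𝒱 : Set (Matrix (Fin K) (Fin K) ℝ)} (h𝒱 : IsCompact 𝒱)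
    (b : ℝ) : IsCompact (stationaryParams 𝒱 b) := by
  have hbox : IsCompact {U : Matrix (Fin K) (Fin K) ℝ | ∀ i j, |U i j| ≤ b} := by
    have h := isCompact_univ_pi fun _ : Fin K => isCompact_univ_pi fun _ : Fin K =>
      isCompact_Icc (a := -b) (b := b)
    simp only [Set.pi, Set.mem_univ, true_imp_iff, Set.mem_Icc, ← abs_le] at h
    exact h
  have hst : IsClosed {p : Params (Fin K) | p.2.1 ᵥ* p.1 = p.2.1} :=
    isClosed_eq (by fun_prop) (by fun_prop)
  have hrow : IsClosed {p : Params (Fin K) | p.2.2 *ᵥ 1 = 1} :=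
    isClosed_eq (by fun_prop) (by fun_prop)
  have heq : stationaryParams 𝒱 b =
      (𝒱 ×ˢ stdSimplex ℝ (Fin K) ×ˢ {U | ∀ i j, |U i j| ≤ b}) ∩
        ({p | p.2.1 ᵥ* p.1 = p.2.1} ∩ {p | p.2.2 *ᵥ 1 = 1}) := by
    ext p
    simp only [stationaryParams, IsStationaryDist, Set.mem_ofPred_eq, Set.mem_inter_iff,
      Set.mem_prod]
    tauto
  rw [heq]
  exact (h𝒱.prod ((isCompact_stdSimplex ℝ (Fin K)).prod hbox)).inter_right (hst.inter hrow)

variable {E : Type*} [NormedAddCommGroup E] [InnerProductSpace ℝ E]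

theorem exists_forall_perm_norm_sub_le (hK : 0 < K) {f : Fin K → E}
    (hf : LinearIndependent ℝ f) {e : E} (hfe : ∀ k, inner ℝ (f k) e = 1)
    {𝒱 : Set (Matrix (Fin K) (Fin K) ℝ)} (h𝒱 : IsCompact 𝒱)
    (hQ1 : ∀ Q ∈ 𝒱, Q *ᵥ 1 = 1) (hdet : ∀ Q ∈ 𝒱, Q.det ≠ 0) (hirr : ∀ Q ∈ 𝒱, Q.IsIrreducible)
    {T : Set (Equiv.Perm (Fin K))} (hT : ∀ Q ∈ 𝒱, symmPerms Q ⊆ T) (B : ℝ) :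
    ∃ C > 0, ∀ Q ∈ 𝒱, ∀ π, IsStationaryDist Q π → ∀ F : Fin K → E,
      (∀ k, inner ℝ (F k) e = 1) → (∀ k, ‖F k‖ ≤ B) → ∀ ε, 0 ≤ ε → TensorDistLE Q π F f ε →
        ∃ τ ∈ T, ∀ s, ‖F s - f (τ s)‖ ≤ C * ε := by
  have : Nonempty (Fin K) := ⟨⟨0, hK⟩⟩
  obtain ⟨D, hD, rfl⟩ := exists_inner_section hf hfe
  let m : Fin K → ℝ := fun j => ‖D (Pi.single j 1)‖
  obtain ⟨C, hC0, hC⟩ := exists_forall_isStableAt hD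
    (isCompact_stationaryParams h𝒱 (B * ‖m‖)) (fun p hp => hp.2.2.2) (fun p hp => hdet _ hp.1)
    (fun p hp => hQ1 _ hp.1) (fun p hp i => (hp.2.1.pos (hirr _ hp.1) i).ne')
    (fun p hp _ hτ => hT _ hp.1 hτ) B
  refine ⟨C, hC0, fun Q hQ π hπ F hFe hFB => ?_⟩
  let Φ : (Fin K → ℝ) →ₗ[ℝ] Fin K → ℝ := LinearMap.pi fun k => innerₛₗ ℝ (F k) ∘ₗ D
  have hU : ∀ x, (fun k => inner ℝ (F k) (D x)) = LinearMap.toMatrix' Φ *ᵥ x := fun x =>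
    (LinearMap.toMatrix'_mulVec Φ x).symm
  have hbound : ∀ i j, |LinearMap.toMatrix' Φ i j| ≤ B * ‖m‖ := fun i j => by
    rw [LinearMap.toMatrix'_apply]
    have hm : m j ≤ ‖m‖ := (le_abs_self _).trans (norm_le_pi_norm m j)
    exact (abs_real_inner_le_norm _ _).trans
      (mul_le_mul (hFB i) hm (norm_nonneg _) ((norm_nonneg _).trans (hFB i)))
  exact hC (Q, π, LinearMap.toMatrix' Φ) ⟨hQ, hπ, hbound, by rw [← hU]; exact funext hFe⟩
    F hFe hFB hU

end Chain

section SquareIntegrable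

variable {α : Type*} [MeasurableSpace α] {μ : Measure α}

theorem memLp_two_mul_prod {β : Type*} [MeasurableSpace β] {ν : Measure β} [SFinite ν]
    {u : α → ℝ} {v : β → ℝ} (hu : MemLp u 2 μ) (hv : MemLp v 2 ν) :
    MemLp (fun z : α × β => u z.1 * v z.2) 2 (μ.prod ν) := by
  refine (memLp_two_iff_integrable_sq
    (hu.aestronglyMeasurable.comp_fst.mul hv.aestronglyMeasurable.comp_snd)).2 ?_
  simpa only [Pi.mul_apply, mul_pow] using hu.integrable_sq.mul_prod hv.integrable_sq

variable [SFinite μ]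

theorem memLp_two_mul_prod₃ {u v w : α → ℝ} (hu : MemLp u 2 μ) (hv : MemLp v 2 μ)
    (hw : MemLp w 2 μ) :
    MemLp (fun y : α × α × α => u y.1 * v y.2.1 * w y.2.2) 2 (μ.prod (μ.prod μ)) := by
  simpa only [mul_assoc] using memLp_two_mul_prod hu (memLp_two_mul_prod hv hw)

/-- The elementary tensor `u ⊗ v ⊗ w`, as a square integrable function of three variables. -/
def tmul₃ (u v w : Lp ℝ 2 μ) : Lp ℝ 2 (μ.prod (μ.prod μ)) :=
  (memLp_two_mul_prod₃ (Lp.memLp u) (Lp.memLp v) (Lp.memLp w)).toLp _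

theorem coeFn_tmul₃ (u v w : Lp ℝ 2 μ) :
    tmul₃ u v w =ᵐ[μ.prod (μ.prod μ)] fun y => u y.1 * v y.2.1 * w y.2.2 :=
  MemLp.coeFn_toLp _

theorem inner_tmul₃ (u v w u' v' w' : Lp ℝ 2 μ) :
    inner ℝ (tmul₃ u v w) (tmul₃ u' v' w') = inner ℝ u u' * inner ℝ v v' * inner ℝ w w' := by
  have hpointwise : (fun y => inner ℝ (tmul₃ u v w y) (tmul₃ u' v' w' y)) =ᵐ[μ.prod (μ.prod μ)]
      fun y => inner ℝ (u y.1) (u' y.1) *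
        (inner ℝ (v y.2.1) (v' y.2.1) * inner ℝ (w y.2.2) (w' y.2.2)) := by
    filter_upwards [coeFn_tmul₃ u v w, coeFn_tmul₃ u' v' w'] with y h h'
    simp only [h, h', RCLike.inner_apply, conj_trivial]
    ring
  simp only [L2.inner_def]
  rw [integral_congr_ae hpointwise, integral_prod_mul (fun x => inner ℝ (u x) (u' x))
    fun z : α × α => inner ℝ (v z.1) (v' z.1) * inner ℝ (w z.2) (w' z.2),
    integral_prod_mul (fun x => inner ℝ (v x) (v' x)) fun x => inner ℝ (w x) (w' x), mul_assoc]

theorem norm_tmul₃ (u v w : Lp ℝ 2 μ) : ‖tmul₃ u v w‖ = ‖u‖ * ‖v‖ * ‖w‖ := by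
  refine (sq_eq_sq₀ (norm_nonneg _) (by positivity)).1 ?_
  rw [← real_inner_self_eq_norm_sq, inner_tmul₃]
  simp only [real_inner_self_eq_norm_sq, mul_pow]

variable {K : ℕ}

/-- The function `tripleFun Q f` as an element of `L²`. -/
def tripleLp (Q : Matrix (Fin K) (Fin K) ℝ) (f : Fin K → Lp ℝ 2 μ) : Lp ℝ 2 (μ.prod (μ.prod μ)) :=
  ∑ k : Fin K × Fin K × Fin K, (stationaryDist Q k.1 * Q k.1 k.2.1 * Q k.2.1 k.2.2) •
    tmul₃ (f k.1) (f k.2.1) (f k.2.2)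

theorem coeFn_tripleLp (Q : Matrix (Fin K) (Fin K) ℝ) (f : Fin K → Lp ℝ 2 μ) :
    tripleLp Q f =ᵐ[μ.prod (μ.prod μ)] tripleFun Q fun k => f k := by
  filter_upwards [Lp.coeFn_finsetSum Finset.univ fun k : Fin K × Fin K × Fin K =>
      (stationaryDist Q k.1 * Q k.1 k.2.1 * Q k.2.1 k.2.2) • tmul₃ (f k.1) (f k.2.1) (f k.2.2),
    eventually_all.2 fun k : Fin K × Fin K × Fin K =>
      Lp.coeFn_smul (stationaryDist Q k.1 * Q k.1 k.2.1 * Q k.2.1 k.2.2)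
        (tmul₃ (f k.1) (f k.2.1) (f k.2.2)),
    eventually_all.2 fun k : Fin K × Fin K × Fin K =>
      coeFn_tmul₃ (f k.1) (f k.2.1) (f k.2.2)] with y hsum hsmul htmul
  rw [tripleLp, hsum, Finset.sum_apply]
  simp only [hsmul, Pi.smul_apply, htmul, smul_eq_mul, Fintype.sum_prod_type, tripleFun]

theorem inner_tripleLp_tmul₃ (Q : Matrix (Fin K) (Fin K) ℝ) (f : Fin K → Lp ℝ 2 μ)
    (u v w : Lp ℝ 2 μ) :
    inner ℝ (tripleLp Q f) (tmul₃ u v w) = tensorForm Q (stationaryDist Q) f u v w := by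
  simp only [tripleLp, sum_inner, real_inner_smul_left, inner_tmul₃, Fintype.sum_prod_type,
    tensorForm, tripleForm_eq_sum]

theorem norm_tripleLp_sub (Q : Matrix (Fin K) (Fin K) ℝ) (F f : Fin K → Lp ℝ 2 μ) :
    ‖tripleLp Q F - tripleLp Q f‖ =
      (eLpNorm (tripleFun Q (fun k => F k) - tripleFun Q fun k => f k) 2
        (μ.prod (μ.prod μ))).toReal := by
  rw [Lp.norm_def, eLpNorm_congr_ae ((Lp.coeFn_sub _ _).trans
    ((coeFn_tripleLp Q F).sub (coeFn_tripleLp Q f)))]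

theorem tensorDistLE_norm_tripleLp_sub (Q : Matrix (Fin K) (Fin K) ℝ) (F f : Fin K → Lp ℝ 2 μ) :
    TensorDistLE Q (stationaryDist Q) F f ‖tripleLp Q F - tripleLp Q f‖ := fun u v w => by
  rw [← inner_tripleLp_tmul₃, ← inner_tripleLp_tmul₃, ← inner_sub_left, ← norm_tmul₃]
  exact abs_real_inner_le_norm _ _

end SquareIntegrable

theorem sqrt_iInf_sum_norm_sq_le {κ ι E : Type*} [Fintype ι] [SeminormedAddGroup E]
    {a : κ → ι → E} {t : κ} {r : ℝ} (hr : 0 ≤ r) (ha : ∀ k, ‖a t k‖ ≤ r) :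
    √(⨅ t, ∑ k, ‖a t k‖ ^ 2) ≤ √(Fintype.card ι) * r := by
  have hbdd : BddBelow (Set.range fun t => ∑ k, ‖a t k‖ ^ 2) :=
    ⟨0, Set.forall_mem_range.2 fun _ => by positivity⟩
  have hsum : ∑ k, ‖a t k‖ ^ 2 ≤ Fintype.card ι * r ^ 2 := by
    rw [← nsmul_eq_mul]
    exact Finset.sum_le_card_nsmul _ _ _ fun k _ => pow_le_pow_left₀ (norm_nonneg _) (ha k) 2
  calc √(⨅ t, ∑ k, ‖a t k‖ ^ 2) ≤ √(Fintype.card ι * r ^ 2) :=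
        Real.sqrt_le_sqrt ((ciInf_le hbdd t).trans hsum)
    _ = √(Fintype.card ι) * r := by rw [Real.sqrt_mul (by positivity), Real.sqrt_sq hr]

end

end HMM

theorem theorem2_general {α : Type*} [MeasurableSpace α] {μ : Measure α} [IsFiniteMeasure μ]
    {K : ℕ} (hK : 0 < K) {f : Fin K → Lp ℝ 2 μ} (hf_int : ∀ k, ∫ y, f k y ∂μ = 1)
    (hf_indep : LinearIndependent ℝ f) {𝒦 : Set (Fin K → Lp ℝ 2 μ)}
    (h𝒦_bdd : Bornology.IsBounded 𝒦) (h𝒦_int : ∀ h ∈ 𝒦, ∀ i, ∫ y, h i y ∂μ = 0)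
    {𝒱 : Set (Matrix (Fin K) (Fin K) ℝ)} (h𝒱_sub : 𝒱 ⊆ HMM.transitionMatrices K)
    (h𝒱_compact : IsCompact 𝒱) (h𝒱_rank : ∀ Q ∈ 𝒱, Q.rank = K)
    (h𝒱_irred : ∀ Q ∈ 𝒱, Q.IsIrreducible)
    (h𝒱_stat : ∀ Q ∈ 𝒱, HMM.IsStationaryDist Q (HMM.stationaryDist Q))
    {T : Set (Equiv.Perm (Fin K))} (hT : ∀ Q ∈ 𝒱, HMM.symmPerms Q ⊆ T) :
    ∃ c : ℝ, 0 < c ∧ ∀ h ∈ 𝒦, ∀ Q ∈ 𝒱,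
      c * √(⨅ τ : T, ∑ k, ‖h k + f k - f (τ.1 k)‖ ^ 2) ≤
        (eLpNorm (HMM.tripleFun Q (fun k => (f + h) k) - HMM.tripleFun Q fun k => f k) 2
          (μ.prod (μ.prod μ))).toReal := by
  let e : Lp ℝ 2 μ := indicatorConstLp 2 MeasurableSet.univ (measure_ne_top μ _) 1
  have he : ∀ u : Lp ℝ 2 μ, inner ℝ u e = ∫ y, u y ∂μ := fun u => by
    rw [real_inner_comm, L2.inner_indicatorConstLp_one, setIntegral_univ]
  obtain ⟨R, hR⟩ := h𝒦_bdd.exists_norm_le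
  obtain ⟨C, hC, hstable⟩ := HMM.exists_forall_perm_norm_sub_le hK hf_indep
    (fun k => (he _).trans (hf_int k)) h𝒱_compact
    (fun Q hQ => Matrix.one_vecMul_of_mem_rowStochastic (h𝒱_sub hQ))
    (fun Q hQ => HMM.det_ne_zero_of_rank_eq_card (by simpa using h𝒱_rank Q hQ)) h𝒱_irred hT
    (‖f‖ + R)
  have hcard : 0 < √(Fintype.card (Fin K)) := by simpa using hK
  refine ⟨(√(Fintype.card (Fin K)) * C)⁻¹, by positivity, fun h hh Q hQ => ?_⟩
  have hFe : ∀ k, inner ℝ ((f + h) k) e = 1 := fun k => by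
    rw [Pi.add_apply, inner_add_left, he, he, hf_int, h𝒦_int h hh, add_zero]
  have hFB : ∀ k, ‖(f + h) k‖ ≤ ‖f‖ + R := fun k =>
    (norm_le_pi_norm (f + h) k).trans ((norm_add_le f h).trans (by gcongr; exact hR h hh))
  obtain ⟨τ, hτ, hdist⟩ := hstable Q hQ _ (h𝒱_stat Q hQ) (f + h) hFe hFB _ (norm_nonneg _)
    (HMM.tensorDistLE_norm_tripleLp_sub Q (f + h) f)
  rw [← HMM.norm_tripleLp_sub, inv_mul_le_iff₀ (by positivity), mul_assoc]
  refine HMM.sqrt_iInf_sum_norm_sq_le (t := ⟨τ, hτ⟩) (by positivity) fun k => ?_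
  rw [add_comm (h k)]
  exact hdist k

theorem theorem2
    (K D : ℕ) (hK : 0 < K) (hD : 0 < D)
    -- the observation space, a set of finite Lebesgue measure
    (Y : Set (EuclideanSpace ℝ (Fin D))) (hY : MeasurableSet Y) (hYfin : volume Y < ∞)
    -- the hidden chain
    (Qstar : Matrix (Fin K) (Fin K) ℝ) (pistar : Fin K → ℝ)
    (hchain : HMM.ChainAssumptions Qstar pistar)
    -- the emission densities, square integrable and linearly independent
    (fstar : Fin K → HMM.L2 Y)
    (hf_nonneg : ∀ k, ∀ᵐ y ∂(volume.restrict Y), 0 ≤ fstar k y)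
    (hf_int : ∀ k, ∫ y, fstar k y ∂(volume.restrict Y) = 1)
    (hf_indep : LinearIndependent ℝ fstar)
    (hHD : HMM.H Qstar (Matrix.gram ℝ fstar) ≠ 0)
    -- the set of perturbations
    (𝒦 : Set (Fin K → HMM.L2 Y)) (h𝒦_closed : IsClosed 𝒦) (h𝒦_bdd : Bornology.IsBounded 𝒦)
    (h𝒦_int : ∀ h ∈ 𝒦, ∀ i, ∫ y, h i y ∂(volume.restrict Y) = 0)
    -- the compact neighbourhood of `Qstar` in the space of transition matrices
    (𝒱 : Set (Matrix (Fin K) (Fin K) ℝ)) (h𝒱_sub : 𝒱 ⊆ HMM.transitionMatrices K)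
    (h𝒱_compact : IsCompact 𝒱) (h𝒱_nhds : 𝒱 ∈ 𝓝[HMM.transitionMatrices K] Qstar)
    (h𝒱_H : ∀ Q ∈ 𝒱, HMM.H Q (Matrix.gram ℝ fstar) ≠ 0)
    (h𝒱_chain : ∀ Q ∈ 𝒱, HMM.ChainAssumptions Q (HMM.stationaryDist Q))
    (h𝒱_symm : ∀ Q ∈ 𝒱, HMM.symmPerms Q ⊆ HMM.symmPerms Qstar) :
    ∃ c : ℝ, 0 < c ∧ ∀ h ∈ 𝒦, ∀ Q ∈ 𝒱,
      c * HMM.permNorm Qstar fstar h ≤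
        HMM.norm3 Y (HMM.g Q (fstar + h) - HMM.g Q fstar) := by
  have : IsFiniteMeasure (volume.restrict Y) := isFiniteMeasure_restrict.2 hYfin.ne
  exact theorem2_general hK hf_int hf_indep h𝒦_bdd h𝒦_int h𝒱_sub h𝒱_compact
    (fun Q hQ => (h𝒱_chain Q hQ).full_rank) (fun Q hQ => (h𝒱_chain Q hQ).irreducible)
    (fun Q hQ => (h𝒱_chain Q hQ).stationary) h𝒱_symm
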